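/- Let $C$ be a binary linear code of length $n$ and dimension $k$, i.e. a $k$-dimensional subspace $C\subseteq\mathbb{F}_2^n$, of full length (for every $1\le i\le n$ some codeword $c\in C$ has $c_i\neq 0$), such that every nonzero codeword of $C$ has Hamming weight $24$ or $32$, and suppose $n\le 56$. Then $k\le 8$. Moreover, if $k=8$, then $n\in\{51,54,55,56\}$. If $(n,k)=(51,8)$, then $C$ is projective, i.e. every nonzero vector of the dual code $C^\perp=\{x\in\mathbb{F}_2^n : \sum_{i=1}^n c_ix_i=0 \text{ for all } c\in C\}$ has Hamming weight at least $3$. -/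

import Mathlib

/-- A binary linear code of length `n`: a linear subspace of `𝔽₂ⁿ`. -/
abbrev BinaryCode (n : ℕ) : Type := Submodule (ZMod 2) (Fin n → ZMod 2)

namespace BinaryCode

variable {n : ℕ}

/-- The dimension of the code over `𝔽₂`. -/
noncomputable def dim (C : BinaryCode n) : ℕ := Module.finrank (ZMod 2) C

/-- The dual code: all vectors perpendicular to every codeword. -/
def dual (C : BinaryCode n) : BinaryCode n where
  carrier := {x | ∀ c ∈ C, c ⬝ᵥ x = 0}
  zero_mem' := by
    intro c _
    exact dotProduct_zero c
  add_mem' := by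
    intro x y hx hy c hc
    rw [dotProduct_add, hx c hc, hy c hc, add_zero]
  smul_mem' := by
    intro a x hx c hc
    rw [dotProduct_smul, hx c hc, smul_zero]

/-- All nonzero codewords have Hamming weight in `W`. -/
def NonzeroWeightsIn (C : BinaryCode n) (W : Set ℕ) : Prop :=
  ∀ c ∈ C, c ≠ 0 → hammingNorm c ∈ W

/-- Full length: no coordinate vanishes identically on the code. -/
def IsFullLength (C : BinaryCode n) : Prop :=
  ∀ i : Fin n, ∃ c ∈ C, c i ≠ 0

/-- Projective: the dual code has minimum weight at least `3`, that is, every nonzero word of the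
dual code has weight at least `3`. -/
def IsProjective (C : BinaryCode n) : Prop :=
  ∀ x ∈ C.dual, x ≠ 0 → 3 ≤ hammingNorm x

end BinaryCode

/-!
Let `X φ` be the number of coordinates inducing the functional `φ` on `C` (`mult`), and let `N φ`
be the number of ordered pairs of coordinates whose functionals add up to `φ` (`pairCount`).
The Fourier transform of `X` is `c ↦ χ c = n - 2 wt(c)` (`charSum`), and that of `N` is `χ²`. On
nonzero words `χ` takes only the values `n - 48` and `n - 64`, so `(χ - (n - 48)) (χ - (n - 64))`
is `3072` times the indicator of the zero word. Inverting the transform gives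
`2 ^ k * (N φ - (2 n - 112) X φ + (n - 48) (n - 64) [φ = 0]) = 3072` (`pairCount_identity`).

This identity decides all cases but one. Divisibility gives `k ≤ 10`. For `k = 9, 10` it bounds
`N (φ + ψ) ≥ 2 X φ X ψ` by `6`, so at most one functional is repeated, while the inequality
`N 0 ≥ n` fails (this covers `n ≤ 51`), or the value of
`∑ X φ (X φ - 1) = N 0 - n` is not of the form `m (m - 1)` for an admissible multiplicity `m`.
For `k = 8` the inequality `N 0 ≥ n` gives `n ≥ 51`; for `n = 51` it is an equality, so that the
coordinate functionals are distinct, which is projectivity; and `n = 52` forces `X ≤ 1` together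
with `N 0 = 60`.

For `k = 8` and `n = 53` there are exactly seven double functionals, and none of them is a sum of
two coordinate functionals. Let `z c` be the character sum over these seven. The sum over `C` of
`(χ - 5) (z + 1) (z + 3) (z + 5)` can be bounded below by expanding into moments, the third of
which only needs the triples with a repeated entry. Conversely, each nonzero word contributes a
positive amount only if `z c = -7`, and a Plotkin-type argument
(`card_doubleSum_eq_neg_seven_le`) leaves at most five such words, too few to reach the bound.
-/

open scoped Classical

namespace BinaryCode

variable {n : ℕ}

/-! ### Characters of the code -/

/-- The nontrivial additive character `𝔽₂ → {1, -1}`, with values in `ℤ`. -/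
def sgn (a : ZMod 2) : ℤ := if a = 0 then 1 else -1

@[simp] theorem sgn_zero : sgn 0 = 1 := rfl

@[simp] theorem sgn_one : sgn 1 = -1 := rfl

theorem sgn_add (a b : ZMod 2) : sgn (a + b) = sgn a * sgn b := by
  revert a b; decide

theorem zmod_two_eq_one {a : ZMod 2} (h : a ≠ 0) : a = 1 := by
  revert a; decide

noncomputable instance (C : BinaryCode n) : Fintype C := Fintype.ofFinite C

noncomputable instance (C : BinaryCode n) : Fintype (Module.Dual (ZMod 2) C) :=
  have : Finite (Module.Dual (ZMod 2) C) := DFunLike.finite _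
  Fintype.ofFinite _

theorem dual_add_self {C : BinaryCode n} (φ : Module.Dual (ZMod 2) C) : φ + φ = 0 := by
  ext c
  exact CharTwo.add_self_eq_zero (φ c)

theorem dual_add_eq_zero_iff {C : BinaryCode n} (φ ψ : Module.Dual (ZMod 2) C) :
    φ + ψ = 0 ↔ φ = ψ := by
  refine ⟨fun h => ?_, fun h => h ▸ dual_add_self φ⟩
  exact add_right_cancel (h.trans (dual_add_self ψ).symm)

theorem dual_add_add_cancel {C : BinaryCode n} (φ ψ : Module.Dual (ZMod 2) C) :
    φ + (φ + ψ) = ψ := by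
  rw [← add_assoc, dual_add_self, zero_add]

/-- Orthogonality of characters on the code. -/
theorem sum_sgn_dual (C : BinaryCode n) (φ : Module.Dual (ZMod 2) C) :
    ∑ c : C, sgn (φ c) = if φ = 0 then 2 ^ C.dim else 0 := by
  split_ifs with h
  · subst h
    have hc : Fintype.card C = 2 ^ C.dim := by
      have h := Module.card_eq_pow_finrank (K := ZMod 2) (V := C)
      rwa [ZMod.card] at h
    simp [hc]
  · obtain ⟨c₀, hc₀⟩ : ∃ c₀, φ c₀ ≠ 0 := by
      by_contra! h0
      exact h (LinearMap.ext h0)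
    have h1 : ∑ c : C, sgn (φ (c + c₀)) = ∑ c : C, sgn (φ c) :=
      Equiv.sum_comp (Equiv.addRight c₀) (fun c => sgn (φ c))
    simp only [map_add, zmod_two_eq_one hc₀, sgn_add, sgn_one, mul_neg, mul_one,
      Finset.sum_neg_distrib] at h1
    linarith

/-- The `i`-th coordinate as a linear functional on the code. -/
def coord (C : BinaryCode n) (i : Fin n) : Module.Dual (ZMod 2) C :=
  (LinearMap.proj i).comp C.subtype

@[simp] theorem coord_apply (C : BinaryCode n) (i : Fin n) (c : C) :
    C.coord i c = (c : Fin n → ZMod 2) i := rfl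

/-- The number of coordinates inducing the functional `φ` on the code: the multiplicity of `φ` in
the multiset of columns of a generator matrix. It is taken in `ℤ`, where the character sums live. -/
noncomputable def mult (C : BinaryCode n) (φ : Module.Dual (ZMod 2) C) : ℤ :=
  ∑ i, if C.coord i = φ then 1 else 0

/-- The character sum `∑ᵢ (-1)^{cᵢ}`, equal to `n - 2 wt(c)`. -/
def charSum (C : BinaryCode n) (c : C) : ℤ := ∑ i, sgn (C.coord i c)

/-- The number of ordered pairs of coordinates whose functionals add up to `φ`. -/
noncomputable def pairCount (C : BinaryCode n) (φ : Module.Dual (ZMod 2) C) : ℤ :=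
  ∑ ψ, C.mult ψ * C.mult (φ + ψ)

theorem mult_nonneg (C : BinaryCode n) (φ : Module.Dual (ZMod 2) C) : 0 ≤ C.mult φ :=
  Finset.sum_nonneg fun i _ => by split_ifs <;> norm_num

theorem mult_zero {C : BinaryCode n} (h : C.IsFullLength) : C.mult 0 = 0 := by
  refine Finset.sum_eq_zero fun i _ => if_neg fun h0 => ?_
  obtain ⟨c, hc, hci⟩ := h i
  exact hci (LinearMap.congr_fun h0 ⟨c, hc⟩)

theorem sum_comp_coord (C : BinaryCode n) (f : Module.Dual (ZMod 2) C → ℤ) :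
    ∑ i, f (C.coord i) = ∑ ψ, C.mult ψ * f ψ := by
  simp only [mult, Finset.sum_mul]
  rw [Finset.sum_comm]
  simp

theorem sum_mult (C : BinaryCode n) : ∑ ψ, C.mult ψ = n := by
  simpa using (C.sum_comp_coord fun _ => 1).symm

theorem pairCount_zero (C : BinaryCode n) : C.pairCount 0 = ∑ ψ, C.mult ψ ^ 2 := by
  simp [pairCount, sq]

theorem sum_mult_mul_pred (C : BinaryCode n) :
    ∑ ψ, C.mult ψ * (C.mult ψ - 1) = C.pairCount 0 - n := by
  rw [pairCount_zero, ← C.sum_mult, ← Finset.sum_sub_distrib]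
  exact Finset.sum_congr rfl fun _ _ => by ring

theorem mult_mul_pred_nonneg (C : BinaryCode n) (ψ : Module.Dual (ZMod 2) C) :
    0 ≤ C.mult ψ * (C.mult ψ - 1) := by
  rcases (C.mult_nonneg ψ).eq_or_lt with h | h
  · simp [← h]
  · exact mul_nonneg h.le (by linarith)

theorem mult_mul_mult_le_pairCount (C : BinaryCode n) (φ ψ : Module.Dual (ZMod 2) C) :
    C.mult ψ * C.mult (φ + ψ) ≤ C.pairCount φ :=
  Finset.single_le_sum (f := fun ψ => C.mult ψ * C.mult (φ + ψ))
    (fun _ _ => mul_nonneg (C.mult_nonneg _) (C.mult_nonneg _)) (Finset.mem_univ ψ)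

theorem pairCount_nonneg (C : BinaryCode n) (φ : Module.Dual (ZMod 2) C) :
    0 ≤ C.pairCount φ :=
  Finset.sum_nonneg fun _ _ => mul_nonneg (C.mult_nonneg _) (C.mult_nonneg _)

/-- The sum of two distinct columns is represented by these two columns in both orders. -/
theorem two_mul_mult_mul_mult_le_pairCount (C : BinaryCode n) {φ ψ : Module.Dual (ZMod 2) C}
    (h : φ ≠ ψ) : 2 * (C.mult φ * C.mult ψ) ≤ C.pairCount (φ + ψ) := by
  have h1 := Finset.sum_le_univ_sum_of_nonneg (s := {φ, ψ})
    (f := fun x => C.mult x * C.mult (φ + ψ + x))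
    (fun _ => mul_nonneg (C.mult_nonneg _) (C.mult_nonneg _))
  rw [Finset.sum_pair h, add_comm (φ + ψ) φ, dual_add_add_cancel, add_assoc, dual_add_self,
    add_zero] at h1
  unfold pairCount
  linarith

theorem charSum_zero (C : BinaryCode n) : C.charSum 0 = n := by
  simp [charSum]

theorem charSum_eq (C : BinaryCode n) (c : C) :
    C.charSum c = n - 2 * hammingNorm (c : Fin n → ZMod 2) := by
  have h : ∀ i, sgn (C.coord i c) =
      1 - 2 * (if (c : Fin n → ZMod 2) i ≠ 0 then 1 else 0) := by
    intro i
    by_cases h0 : (c : Fin n → ZMod 2) i = 0 <;> simp [sgn, h0]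
  simp only [charSum, h, Finset.sum_sub_distrib, ← Finset.mul_sum, Finset.sum_boole]
  simp [hammingNorm]

/-- Fourier inversion for the multiset of columns. -/
theorem sum_charSum_mul (C : BinaryCode n) (φ : Module.Dual (ZMod 2) C) :
    ∑ c, C.charSum c * sgn (φ c) = 2 ^ C.dim * C.mult φ := by
  simp only [charSum, Finset.sum_mul, mult, Finset.mul_sum]
  rw [Finset.sum_comm]
  refine Finset.sum_congr rfl fun i _ => ?_
  simp only [← sgn_add, ← LinearMap.add_apply, sum_sgn_dual, dual_add_eq_zero_iff]
  simp

theorem sum_charSum {C : BinaryCode n} (hfull : C.IsFullLength) : ∑ c, C.charSum c = 0 := by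
  have := C.sum_charSum_mul 0
  simpa [mult_zero hfull] using this

theorem sum_charSum_sq_mul (C : BinaryCode n) (φ : Module.Dual (ZMod 2) C) :
    ∑ c, C.charSum c ^ 2 * sgn (φ c) = 2 ^ C.dim * C.pairCount φ := by
  have h : ∀ c, C.charSum c ^ 2 * sgn (φ c)
      = ∑ i, C.charSum c * sgn ((φ + C.coord i) c) := by
    intro c
    simp only [LinearMap.add_apply, sgn_add]
    rw [← Finset.mul_sum, ← Finset.mul_sum, ← charSum]
    ring
  simp only [h]
  rw [Finset.sum_comm]
  simp only [sum_charSum_mul]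
  rw [← Finset.mul_sum, C.sum_comp_coord (fun ψ => C.mult (φ + ψ)), pairCount]

theorem charSum_of_ne_zero {C : BinaryCode n} (hw : C.NonzeroWeightsIn {24, 32}) {c : C}
    (hc : c ≠ 0) : C.charSum c = n - 48 ∨ C.charSum c = n - 64 := by
  have h := hw c c.2 (by simpa using hc)
  rw [charSum_eq]
  rcases h with h | h
  · left; rw [h]; norm_num
  · right; rw [Set.mem_singleton_iff.mp h]; norm_num

/-- Since the character sum takes only the values `n - 48` and `n - 64` off the zero word,
the corresponding quadratic polynomial in it is supported at the zero word. -/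
theorem pairCount_identity {C : BinaryCode n} (hw : C.NonzeroWeightsIn {24, 32})
    (φ : Module.Dual (ZMod 2) C) :
    2 ^ C.dim * (C.pairCount φ - (2 * n - 112) * C.mult φ
      + (n - 48) * (n - 64) * (if φ = 0 then 1 else 0)) = 3072 := by
  have h1 : ∑ c, (C.charSum c - (n - 48)) * (C.charSum c - (n - 64)) * sgn (φ c) = 3072 := by
    rw [Finset.sum_eq_single 0]
    · rw [charSum_zero]
      simp
    · intro c _ hc
      rcases charSum_of_ne_zero hw hc with h | h <;> simp [h]
    · simp
  have h2 : ∀ c, (C.charSum c - (n - 48)) * (C.charSum c - (n - 64)) * sgn (φ c)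
      = C.charSum c ^ 2 * sgn (φ c) - (2 * n - 112) * (C.charSum c * sgn (φ c))
        + (n - 48) * (n - 64) * sgn (φ c) := fun c => by ring
  simp only [h2, Finset.sum_add_distrib, Finset.sum_sub_distrib, ← Finset.mul_sum,
    sum_charSum_sq_mul, sum_charSum_mul, sum_sgn_dual] at h1
  rw [← h1]
  split_ifs <;> ring

theorem length_le_pairCount_zero (C : BinaryCode n) : (n : ℤ) ≤ C.pairCount 0 := by
  have := Finset.sum_nonneg fun ψ (_ : ψ ∈ Finset.univ) => C.mult_mul_pred_nonneg ψ
  rw [sum_mult_mul_pred] at this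
  linarith

/-! ### Dimension at least nine -/

theorem dim_le_ten {C : BinaryCode n} (hw : C.NonzeroWeightsIn {24, 32}) : C.dim ≤ 10 := by
  by_contra! h
  have h1 : (2 : ℤ) ^ 11 ∣ 3072 :=
    (pow_dvd_pow 2 h).trans (Dvd.intro _ (pairCount_identity hw 0))
  norm_num at h1

/-- In dimension nine or ten each nonzero functional is represented at most six times as a sum of
two columns, so that two distinct repeated columns cannot exist. -/
theorem dim_ne_nine_or_ten {C : BinaryCode n} (hfull : C.IsFullLength)
    (hw : C.NonzeroWeightsIn {24, 32}) (hn : n ≤ 56) : ¬ (C.dim = 9 ∨ C.dim = 10) := by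
  intro hk
  obtain ⟨l, hl, hlam⟩ : ∃ l : ℤ, (l = 6 ∨ l = 3) ∧ ∀ φ : Module.Dual (ZMod 2) C,
      C.pairCount φ - (2 * n - 112) * C.mult φ
        + (n - 48) * (n - 64) * (if φ = 0 then 1 else 0) = l := by
    rcases hk with hk | hk
    · refine ⟨6, .inl rfl, fun φ => ?_⟩
      have := pairCount_identity hw φ
      rw [hk] at this
      linarith
    · refine ⟨3, .inr rfl, fun φ => ?_⟩
      have := pairCount_identity hw φ
      rw [hk] at this
      linarith
  have hn' : (n : ℤ) ≤ 56 := by exact_mod_cast hn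
  have hzero := hlam 0
  rw [mult_zero hfull, if_pos rfl] at hzero
  have hsum := C.sum_mult_mul_pred
  have hle := C.length_le_pairCount_zero
  have hpair : ∀ φ ψ, φ ≠ ψ → C.mult φ * C.mult ψ ≤ 3 := by
    intro φ ψ hne
    have h1 := C.two_mul_mult_mul_mult_le_pairCount hne
    have h2 := hlam (φ + ψ)
    rw [if_neg (mt (dual_add_eq_zero_iff φ ψ).mp hne)] at h2
    have h3 := mul_nonneg (by linarith : (0 : ℤ) ≤ 112 - 2 * n) (C.mult_nonneg (φ + ψ))
    rcases hl with rfl | rfl <;> linarith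
  have hn52 : 52 ≤ n := by
    by_contra! h
    interval_cases n <;> rcases hl with rfl | rfl <;> norm_num at hzero hle <;> linarith
  have hpos : 0 < ∑ ψ, C.mult ψ * (C.mult ψ - 1) := by
    rw [hsum]
    interval_cases n <;> rcases hl with rfl | rfl <;> norm_num at hzero hle ⊢ <;> linarith
  obtain ⟨φ, -, hφ⟩ := Finset.exists_lt_of_sum_lt (s := Finset.univ) (f := fun _ => (0 : ℤ))
    (g := fun ψ => C.mult ψ * (C.mult ψ - 1)) (by simpa using hpos)
  -- As `φ` is the only repeated functional, `m * (m - 1) = N 0 - n` for its multiplicity `m`.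
  have hφ2 : 2 ≤ C.mult φ := by
    have := C.mult_nonneg φ
    by_contra! h
    have : C.mult φ = 0 ∨ C.mult φ = 1 := by omega
    rcases this with h | h <;> simp [h] at hφ
  have hφ0 : φ ≠ 0 := by
    rintro rfl
    rw [mult_zero hfull] at hφ2
    omega
  rw [Finset.sum_eq_single φ (fun ψ _ hne => ?_) (by simp)] at hsum
  · have h1 := hlam φ
    rw [if_neg hφ0] at h1
    have h2 := C.pairCount_nonneg φ
    have hφ4 : C.mult φ ≤ 4 := by
      by_contra! h
      have : 20 ≤ C.mult φ * (C.mult φ - 1) := by nlinarith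
      interval_cases n <;> rcases hl with rfl | rfl <;> norm_num at hzero hsum <;> linarith
    generalize C.mult φ = m at *
    interval_cases m <;> interval_cases n <;> rcases hl with rfl | rfl <;> norm_num at * <;>
      linarith
  · have h1 := hpair φ ψ hne.symm
    have h2 := C.mult_nonneg ψ
    have : C.mult ψ = 0 ∨ C.mult ψ = 1 := by
      have : C.mult ψ < 2 := by nlinarith
      omega
    rcases this with h | h <;> simp [h]

/-! ### Dimension eight -/

theorem pairCount_of_dim_eq_eight {C : BinaryCode n} (hw : C.NonzeroWeightsIn {24, 32})
    (hk : C.dim = 8) (φ : Module.Dual (ZMod 2) C) :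
    C.pairCount φ = 12 + (2 * n - 112) * C.mult φ
      - (n - 48) * (n - 64) * (if φ = 0 then 1 else 0) := by
  have := pairCount_identity hw φ
  rw [hk] at this
  linarith

theorem length_of_dim_eq_eight {C : BinaryCode n} (hfull : C.IsFullLength)
    (hw : C.NonzeroWeightsIn {24, 32}) (hn : n ≤ 56) (hk : C.dim = 8) : 51 ≤ n ∧ n ≠ 52 := by
  have hzero := pairCount_of_dim_eq_eight hw hk 0
  rw [mult_zero hfull, if_pos rfl] at hzero
  have hle := C.length_le_pairCount_zero
  constructor
  · by_contra! h
    interval_cases n <;> norm_num at hzero hle <;> linarith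
  · rintro rfl
    have h1 : ∀ φ : Module.Dual (ZMod 2) C, C.mult φ * (C.mult φ - 1) = 0 := by
      intro φ
      by_cases h0 : φ = 0
      · rw [h0, mult_zero hfull, zero_mul]
      have h2 := pairCount_of_dim_eq_eight hw hk φ
      have h3 := C.pairCount_nonneg φ
      have h4 := C.mult_nonneg φ
      rw [if_neg h0] at h2
      have : C.mult φ = 0 ∨ C.mult φ = 1 := by push_cast at h2; omega
      rcases this with h | h <;> simp [h]
    have h2 := C.sum_mult_mul_pred
    simp only [h1, Finset.sum_const_zero] at h2
    push_cast at hzero h2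
    linarith

theorem coord_injective_of_length_eq {C : BinaryCode 51} (hfull : C.IsFullLength)
    (hw : C.NonzeroWeightsIn {24, 32}) (hk : C.dim = 8) : Function.Injective C.coord := by
  have hzero := pairCount_of_dim_eq_eight hw hk 0
  rw [mult_zero hfull, if_pos rfl] at hzero
  have hsum := C.sum_mult_mul_pred
  rw [hzero] at hsum
  norm_num at hsum
  rw [Finset.sum_eq_zero_iff_of_nonneg fun ψ _ => C.mult_mul_pred_nonneg ψ] at hsum
  intro i j hij
  by_contra hne
  have h1 := hsum (C.coord j) (Finset.mem_univ _)
  have h2 : 2 ≤ C.mult (C.coord j) := by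
    have := Finset.sum_le_univ_sum_of_nonneg (s := {i, j})
      (f := fun l => if C.coord l = C.coord j then (1 : ℤ) else 0)
      (fun l => by split_ifs <;> norm_num)
    rw [Finset.sum_pair hne, if_pos hij, if_pos rfl] at this
    exact this
  nlinarith

theorem isProjective_of_coord_injective {C : BinaryCode n} (hfull : C.IsFullLength)
    (hinj : Function.Injective C.coord) : C.IsProjective := by
  intro x hx hx0
  have hdot : ∀ c ∈ C, ∑ i ∈ Finset.univ.filter (fun i => x i ≠ 0), c i = 0 := by
    intro c hc
    refine Eq.trans ?_ (hx c hc)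
    rw [dotProduct, Finset.sum_filter]
    refine Finset.sum_congr rfl fun i _ => ?_
    split_ifs with h
    · rw [zmod_two_eq_one h, mul_one]
    · rw [not_not.mp h, mul_zero]
  have hpos : hammingNorm x ≠ 0 := hammingNorm_ne_zero_iff.mpr hx0
  have hcard : hammingNorm x = (Finset.univ.filter fun i => x i ≠ 0).card := by
    simp [hammingNorm]
  by_contra! hlt
  have : hammingNorm x = 1 ∨ hammingNorm x = 2 := by omega
  rcases this with h | h <;> rw [hcard] at h
  · obtain ⟨i, hi⟩ := Finset.card_eq_one.mp h
    obtain ⟨c, hc, hci⟩ := hfull i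
    have := hdot c hc
    rw [hi, Finset.sum_singleton] at this
    exact hci this
  · obtain ⟨i, j, hij, hs⟩ := Finset.card_eq_two.mp h
    refine hij (hinj (LinearMap.ext fun c => ?_))
    have := hdot c c.2
    rw [hs, Finset.sum_pair hij] at this
    exact CharTwo.add_eq_zero.mp this

/-! ### Dimension eight and length fifty-three -/

/-- The functionals represented by exactly two coordinates. -/
noncomputable def doubles (C : BinaryCode n) : Finset (Module.Dual (ZMod 2) C) :=
  Finset.univ.filter fun φ => C.mult φ = 2

/-- The character sum of a codeword over the double functionals, each counted once. -/
noncomputable def doubleSum (C : BinaryCode n) (c : C) : ℤ := ∑ φ ∈ C.doubles, sgn (φ c)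

theorem mem_doubles {C : BinaryCode n} {φ : Module.Dual (ZMod 2) C} :
    φ ∈ C.doubles ↔ C.mult φ = 2 := by
  simp [doubles]

theorem zero_notMem_doubles {C : BinaryCode n} (hfull : C.IsFullLength) :
    (0 : Module.Dual (ZMod 2) C) ∉ C.doubles := by
  rw [mem_doubles, mult_zero hfull]
  norm_num

theorem mult_le_two {C : BinaryCode 53} (hfull : C.IsFullLength)
    (hw : C.NonzeroWeightsIn {24, 32}) (hk : C.dim = 8) (φ : Module.Dual (ZMod 2) C) :
    C.mult φ ≤ 2 := by
  by_cases h0 : φ = 0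
  · rw [h0, mult_zero hfull]; norm_num
  have h2 := pairCount_of_dim_eq_eight hw hk φ
  have h3 := C.pairCount_nonneg φ
  rw [if_neg h0] at h2
  push_cast at h2
  omega

theorem card_doubles {C : BinaryCode 53} (hfull : C.IsFullLength)
    (hw : C.NonzeroWeightsIn {24, 32}) (hk : C.dim = 8) : C.doubles.card = 7 := by
  have hsum := C.sum_mult_mul_pred
  rw [pairCount_of_dim_eq_eight hw hk 0, mult_zero hfull, if_pos rfl] at hsum
  have h1 : ∀ φ : Module.Dual (ZMod 2) C,
      C.mult φ * (C.mult φ - 1) = 2 * if C.mult φ = 2 then 1 else 0 := by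
    intro φ
    have h2 := mult_le_two hfull hw hk φ
    have h3 := C.mult_nonneg φ
    generalize C.mult φ = m at *
    interval_cases m <;> norm_num
  simp only [h1, ← Finset.mul_sum, Finset.sum_boole] at hsum
  norm_num at hsum
  have : ((C.doubles.card : ℕ) : ℤ) = 7 := by
    unfold doubles
    linarith
  exact_mod_cast this

/-- A double functional is not a sum of two columns. -/
theorem mult_add_of_mem_doubles {C : BinaryCode 53} (hfull : C.IsFullLength)
    (hw : C.NonzeroWeightsIn {24, 32}) (hk : C.dim = 8)
    {φ ψ : Module.Dual (ZMod 2) C} (hφ : φ ∈ C.doubles)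
    (hψ : ψ ∈ C.doubles) : C.mult (φ + ψ) = 0 := by
  rw [mem_doubles] at hφ hψ
  have h0 : φ ≠ 0 := by
    rintro rfl
    rw [mult_zero hfull] at hφ
    norm_num at hφ
  have h1 := pairCount_of_dim_eq_eight hw hk φ
  rw [if_neg h0, hφ] at h1
  have h2 := C.mult_mul_mult_le_pairCount φ ψ
  rw [h1, hψ] at h2
  have h3 := C.mult_nonneg (φ + ψ)
  norm_num at h2
  linarith

theorem sum_charSum_mul_doubleSum {C : BinaryCode 53} (hfull : C.IsFullLength)
    (hw : C.NonzeroWeightsIn {24, 32}) (hk : C.dim = 8) :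
    ∑ c, C.charSum c * C.doubleSum c = 256 * 14 := by
  simp only [doubleSum, Finset.mul_sum]
  rw [Finset.sum_comm]
  simp only [sum_charSum_mul, hk]
  rw [Finset.sum_congr rfl fun φ hφ => by rw [mem_doubles.mp hφ], Finset.sum_const,
    card_doubles hfull hw hk]
  norm_num

theorem sum_charSum_mul_doubleSum_sq {C : BinaryCode 53} (hfull : C.IsFullLength)
    (hw : C.NonzeroWeightsIn {24, 32}) (hk : C.dim = 8) :
    ∑ c, C.charSum c * C.doubleSum c ^ 2 = 0 := by
  have h : ∀ c, C.charSum c * C.doubleSum c ^ 2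
      = ∑ φ ∈ C.doubles, ∑ ψ ∈ C.doubles, C.charSum c * sgn ((φ + ψ) c) := by
    intro c
    simp only [LinearMap.add_apply, sgn_add, ← Finset.mul_sum, ← Finset.sum_mul]
    simp only [doubleSum]
    ring
  simp only [h]
  rw [Finset.sum_comm]
  refine Finset.sum_eq_zero fun φ hφ => ?_
  rw [Finset.sum_comm]
  refine Finset.sum_eq_zero fun ψ hψ => ?_
  rw [sum_charSum_mul, mult_add_of_mem_doubles hfull hw hk hφ hψ, mul_zero]

/-- Only the degenerate triples of double functionals, those with a repeated entry, are
counted in this lower bound. -/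
theorem le_sum_charSum_mul_doubleSum_cube {C : BinaryCode 53} (hfull : C.IsFullLength)
    (hw : C.NonzeroWeightsIn {24, 32}) (hk : C.dim = 8) :
    256 * 266 ≤ ∑ c, C.charSum c * C.doubleSum c ^ 3 := by
  have h : ∀ c, C.charSum c * C.doubleSum c ^ 3
      = ∑ φ ∈ C.doubles, ∑ ψ ∈ C.doubles, ∑ θ ∈ C.doubles,
        C.charSum c * sgn ((φ + ψ + θ) c) := by
    intro c
    simp only [LinearMap.add_apply, sgn_add, ← Finset.mul_sum, ← Finset.sum_mul]
    simp only [doubleSum]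
    ring
  have h2 : ∑ c, C.charSum c * C.doubleSum c ^ 3
      = 256 * ∑ φ ∈ C.doubles, ∑ ψ ∈ C.doubles, ∑ θ ∈ C.doubles, C.mult (φ + ψ + θ) := by
    simp only [h, Finset.mul_sum]
    rw [Finset.sum_comm]
    refine Finset.sum_congr rfl fun φ _ => ?_
    rw [Finset.sum_comm]
    refine Finset.sum_congr rfl fun ψ _ => ?_
    rw [Finset.sum_comm]
    refine Finset.sum_congr rfl fun θ _ => ?_
    rw [sum_charSum_mul, hk]
    norm_num
  have h3 : ∑ φ ∈ C.doubles, ∑ ψ ∈ C.doubles, ∑ θ ∈ C.doubles,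
      2 * ((if φ = ψ then 1 else 0) + (if ψ = θ then 1 else 0) + (if φ = θ then 1 else 0)
        - 2 * (if φ = ψ then if ψ = θ then (1 : ℤ) else 0 else 0))
      ≤ ∑ φ ∈ C.doubles, ∑ ψ ∈ C.doubles, ∑ θ ∈ C.doubles, C.mult (φ + ψ + θ) := by
    refine Finset.sum_le_sum fun φ hφ => Finset.sum_le_sum fun ψ hψ =>
      Finset.sum_le_sum fun θ hθ => ?_
    rw [mem_doubles] at hφ hψ hθ
    by_cases h1 : φ = ψ
    · subst h1
      rw [dual_add_self, zero_add, hθ]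
      by_cases h2 : φ = θ <;> simp [h2]
    · by_cases h2 : ψ = θ
      · subst h2
        rw [add_assoc φ ψ ψ, dual_add_self, add_zero, hφ]
        simp [h1]
      · by_cases h3 : φ = θ
        · subst h3
          rw [add_comm (φ + ψ), dual_add_add_cancel, hψ]
          simp [h1, h2]
        · simp [h1, h2, h3, C.mult_nonneg]
  have h4 : ∑ φ ∈ C.doubles, ∑ ψ ∈ C.doubles, ∑ θ ∈ C.doubles,
      2 * ((if φ = ψ then 1 else 0) + (if ψ = θ then 1 else 0) + (if φ = θ then 1 else 0)
        - 2 * (if φ = ψ then if ψ = θ then (1 : ℤ) else 0 else 0)) = 266 := by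
    have hc := card_doubles hfull hw hk
    simp only [← Finset.mul_sum, Finset.sum_add_distrib, Finset.sum_sub_distrib, Finset.sum_const,
      hc, Finset.sum_ite_eq, Finset.sum_ite_irrel]
    simp +contextual [hc]
  rw [h2]
  linarith

theorem sum_doubleSum {C : BinaryCode n} (hfull : C.IsFullLength) : ∑ c, C.doubleSum c = 0 := by
  simp only [doubleSum]
  rw [Finset.sum_comm]
  refine Finset.sum_eq_zero fun φ hφ => ?_
  rw [sum_sgn_dual, if_neg]
  rintro rfl
  exact zero_notMem_doubles hfull hφ

theorem sum_doubleSum_sq {C : BinaryCode 53} (hfull : C.IsFullLength)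
    (hw : C.NonzeroWeightsIn {24, 32}) (hk : C.dim = 8) : ∑ c, C.doubleSum c ^ 2 = 256 * 7 := by
  have h : ∀ c, C.doubleSum c ^ 2
      = ∑ φ ∈ C.doubles, ∑ ψ ∈ C.doubles, sgn ((φ + ψ) c) := by
    intro c
    simp only [LinearMap.add_apply, sgn_add, ← Finset.mul_sum, ← Finset.sum_mul]
    simp only [doubleSum]
    ring
  simp only [h]
  rw [Finset.sum_comm]
  trans ∑ φ ∈ C.doubles, 256
  swap
  · rw [Finset.sum_const, card_doubles hfull hw hk]
    norm_num
  refine Finset.sum_congr rfl fun φ hφ => ?_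
  rw [Finset.sum_comm]
  simp only [sum_sgn_dual, dual_add_eq_zero_iff, hk]
  rw [Finset.sum_ite_eq, if_pos hφ]
  norm_num

theorem sum_doubleSum_cube {C : BinaryCode 53} (hfull : C.IsFullLength)
    (hw : C.NonzeroWeightsIn {24, 32}) (hk : C.dim = 8) : ∑ c, C.doubleSum c ^ 3 = 0 := by
  have h : ∀ c, C.doubleSum c ^ 3
      = ∑ φ ∈ C.doubles, ∑ ψ ∈ C.doubles, ∑ θ ∈ C.doubles, sgn ((φ + ψ + θ) c) := by
    intro c
    simp only [LinearMap.add_apply, sgn_add, ← Finset.mul_sum, ← Finset.sum_mul]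
    simp only [doubleSum]
    ring
  simp only [h]
  rw [Finset.sum_comm]
  refine Finset.sum_eq_zero fun φ hφ => ?_
  rw [Finset.sum_comm]
  refine Finset.sum_eq_zero fun ψ hψ => ?_
  rw [Finset.sum_comm]
  refine Finset.sum_eq_zero fun θ hθ => ?_
  rw [sum_sgn_dual, if_neg]
  intro h0
  rw [dual_add_eq_zero_iff] at h0
  have h1 := mult_add_of_mem_doubles hfull hw hk hφ hψ
  rw [h0, mem_doubles.mp hθ] at h1
  norm_num at h1

theorem doubleSum_cases {C : BinaryCode 53} (hfull : C.IsFullLength)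
    (hw : C.NonzeroWeightsIn {24, 32}) (hk : C.dim = 8) (c : C) :
    ∃ j : ℕ, j ≤ 7 ∧ C.doubleSum c = 7 - 2 * j := by
  refine ⟨(C.doubles.filter fun φ => φ c ≠ 0).card, ?_, ?_⟩
  · rw [← card_doubles hfull hw hk]
    exact Finset.card_filter_le _ _
  · have h : ∀ φ : Module.Dual (ZMod 2) C, sgn (φ c) = 1 - 2 * (if φ c ≠ 0 then 1 else 0) := by
      intro φ
      by_cases h0 : φ c = 0 <;> simp [sgn, h0]
    simp only [doubleSum, h, Finset.sum_sub_distrib, ← Finset.mul_sum, Finset.sum_boole,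
      Finset.sum_const, card_doubles hfull hw hk]
    norm_num

/-- The codewords equal to `1` on all double coordinates are pairwise far apart on the remaining
`39` coordinates, so a Plotkin-type estimate bounds their number. -/
theorem card_doubleSum_eq_neg_seven_le {C : BinaryCode 53} (hfull : C.IsFullLength)
    (hw : C.NonzeroWeightsIn {24, 32}) (hk : C.dim = 8) :
    (Finset.univ.filter fun c : C => C.doubleSum c = -7).card ≤ 5 := by
  set T := Finset.univ.filter fun c : C => C.doubleSum c = -7 with hT
  have hneg : ∀ c ∈ T, ∀ φ ∈ C.doubles, sgn (φ c) = -1 := by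
    intro c hc φ hφ
    have h1 : ∑ ψ ∈ C.doubles, (sgn (ψ c) + 1) = 0 := by
      have h2 : C.doubleSum c = -7 := by simpa [hT] using hc
      rw [Finset.sum_add_distrib, ← doubleSum, h2, Finset.sum_const, card_doubles hfull hw hk]
      norm_num
    rw [Finset.sum_eq_zero_iff_of_nonneg] at h1
    · linarith [h1 φ hφ]
    · intro ψ _
      unfold sgn
      split_ifs <;> norm_num
  -- The Gram sum of the sign vectors over `T`, evaluated by coordinates.
  have hcols : ∑ c ∈ T, ∑ d ∈ T, C.charSum (c + d)
      = ∑ φ, C.mult φ * (∑ c ∈ T, sgn (φ c)) ^ 2 := by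
    rw [← C.sum_comp_coord (fun φ => (∑ c ∈ T, sgn (φ c)) ^ 2)]
    simp only [charSum, map_add, sgn_add, sq, Finset.sum_mul_sum]
    symm
    rw [Finset.sum_comm]
    exact Finset.sum_congr rfl fun c _ => Finset.sum_comm
  have hlower : 14 * (T.card : ℤ) ^ 2 ≤ ∑ c ∈ T, ∑ d ∈ T, C.charSum (c + d) := by
    rw [hcols]
    refine le_trans (le_of_eq ?_) (Finset.sum_le_univ_sum_of_nonneg (s := C.doubles)
      fun φ => mul_nonneg (C.mult_nonneg φ) (sq_nonneg _))
    have : ∀ φ ∈ C.doubles, C.mult φ * (∑ c ∈ T, sgn (φ c)) ^ 2 = 2 * (T.card : ℤ) ^ 2 := by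
      intro φ hφ
      rw [mem_doubles.mp hφ, Finset.sum_congr rfl fun c hc => hneg c hc φ hφ]
      simp
    rw [Finset.sum_congr rfl this, Finset.sum_const, card_doubles hfull hw hk]
    norm_num
    ring
  have hupper : ∑ c ∈ T, ∑ d ∈ T, C.charSum (c + d)
      ≤ ∑ c ∈ T, ∑ d ∈ T, (5 + 48 * if c = d then 1 else 0) := by
    refine Finset.sum_le_sum fun c _ => Finset.sum_le_sum fun d _ => ?_
    by_cases h : c = d
    · have : c + d = 0 := by
        rw [h]
        ext i
        exact CharTwo.add_self_eq_zero _
      rw [this, charSum_zero, if_pos h]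
      norm_num
    · have : c + d ≠ 0 := by
        intro h0
        apply h
        ext i
        exact CharTwo.add_eq_zero.mp (congrFun (congrArg Subtype.val h0) i)
      rw [if_neg h]
      rcases charSum_of_ne_zero hw this with h | h <;> rw [h] <;> norm_num
  have heq : ∑ c ∈ T, ∑ d ∈ T, (5 + 48 * if c = d then (1 : ℤ) else 0)
      = 5 * (T.card : ℤ) ^ 2 + 48 * T.card := by
    simp [Finset.sum_add_distrib]
    ring
  by_contra! h
  have : (6 : ℤ) ≤ T.card := by exact_mod_cast h
  nlinarith

/-- The cubic `(z + 1) (z + 3) (z + 5)` is nonnegative on all possible values of `z` except `-7`, so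
that its correlation with `χ - 5`, which is `0` or `-16` on nonzero words, is controlled by the
number of words with `z = -7`. -/
theorem not_dim_eq_eight_of_length_fiftythree {C : BinaryCode 53} (hfull : C.IsFullLength)
    (hw : C.NonzeroWeightsIn {24, 32}) (hk : C.dim = 8) : False := by
  have hcube := le_sum_charSum_mul_doubleSum_cube hfull hw hk
  have hcard : ∑ _c : C, (1 : ℤ) = 256 := by
    have := C.sum_sgn_dual 0
    rw [if_pos rfl, hk] at this
    simpa using this
  have hlow : 50688 ≤ ∑ c, (C.charSum c - 5)
      * ((C.doubleSum c + 1) * (C.doubleSum c + 3) * (C.doubleSum c + 5)) := by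
    have h : ∀ c, (C.charSum c - 5)
        * ((C.doubleSum c + 1) * (C.doubleSum c + 3) * (C.doubleSum c + 5))
        = C.charSum c * C.doubleSum c ^ 3 + 9 * (C.charSum c * C.doubleSum c ^ 2)
          + 23 * (C.charSum c * C.doubleSum c) + 15 * C.charSum c
          - 5 * C.doubleSum c ^ 3 - 45 * C.doubleSum c ^ 2 - 115 * C.doubleSum c
          - 75 * 1 := fun c => by ring
    simp only [h, Finset.sum_add_distrib, Finset.sum_sub_distrib, ← Finset.mul_sum]
    rw [hcard, sum_charSum_mul_doubleSum_sq hfull hw hk, sum_charSum_mul_doubleSum hfull hw hk,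
      sum_charSum hfull, sum_doubleSum_cube hfull hw hk, sum_doubleSum_sq hfull hw hk,
      sum_doubleSum hfull]
    linarith
  have hup : ∑ c, (C.charSum c - 5)
      * ((C.doubleSum c + 1) * (C.doubleSum c + 3) * (C.doubleSum c + 5))
      ≤ ∑ c : C, (46080 * (if c = 0 then 1 else 0)
        + 768 * if C.doubleSum c = -7 then 1 else 0) := by
    refine Finset.sum_le_sum fun c _ => ?_
    by_cases h0 : c = 0
    · subst h0
      have h1 : C.doubleSum 0 = 7 := by simp [doubleSum, card_doubles hfull hw hk]
      rw [charSum_zero, h1]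
      norm_num
    · obtain ⟨j, hj, hj'⟩ := doubleSum_cases hfull hw hk c
      rw [hj', if_neg h0]
      rcases charSum_of_ne_zero hw h0 with h | h <;> rw [h] <;> interval_cases j <;> norm_num
  rw [Finset.sum_add_distrib, ← Finset.mul_sum, ← Finset.mul_sum, Finset.sum_ite_eq',
    if_pos (Finset.mem_univ _), Finset.sum_boole] at hup
  have hT : ((Finset.univ.filter fun c : C => C.doubleSum c = -7).card : ℤ) ≤ 5 := by
    exact_mod_cast card_doubleSum_eq_neg_seven_le hfull hw hk
  linarith

end BinaryCode

theorem mainTheorem5 (n k : ℕ) (C : BinaryCode n) (hdim : C.dim = k)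
    (hfull : C.IsFullLength) (hweights : C.NonzeroWeightsIn {24, 32}) (hn : n ≤ 56) :
    k ≤ 8 ∧
    (k = 8 → n ∈ ({51, 54, 55, 56} : Set ℕ)) ∧
    (n = 51 ∧ k = 8 → C.IsProjective) := by
  refine ⟨?_, fun hk => ?_, ?_⟩
  · have h1 := BinaryCode.dim_le_ten hweights
    have h2 := BinaryCode.dim_ne_nine_or_ten hfull hweights hn
    omega
  · have hk8 : C.dim = 8 := hdim.trans hk
    obtain ⟨h1, h2⟩ := BinaryCode.length_of_dim_eq_eight hfull hweights hn hk8
    have h3 : n ≠ 53 := by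
      rintro rfl
      exact BinaryCode.not_dim_eq_eight_of_length_fiftythree hfull hweights hk8
    simp only [Set.mem_insert_iff, Set.mem_singleton_iff]
    omega
  · rintro ⟨rfl, rfl⟩
    exact BinaryCode.isProjective_of_coord_injective hfull
      (BinaryCode.coord_injective_of_length_eq hfull hweights hdim)
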